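/- Let $G=(V,E)$ be a finite simple connected graph. For a set $E'\subseteq E$ and link costs $n_e\ge 0$ $(e\in E)$ write $c(E')=\sum_{e\in E'} n_e$. The graph $G$ is called separable if there exist non-negative real costs $(n_e)_{e\in E}$ and a real threshold $\alpha$ such that, for every $E'\subseteq E$, $c(E')\ge\alpha$ if and only if the spanning subgraph $(V,E')$ is connected. Let $c(G)$ be the corank of $G$, i.e. its number of independent cycles (the dimension of the cycle space of $G$ over $\mathbb{F}_2$; for connected $G$ it equals $|E|-|V|+1$), and let $\lambda(G)$ be the link connectivity of $G$, i.e. the least number of links whose removal disconnects $G$ (with $\lambda(G)=0$ if $|V|=1$). The level of difficulty of $G$ is $d(G)=c(G)-\lambda(G)-1$, and $G$ is called easy if $d(G)\le 0$. If $G$ is separable, then $G$ is easy, i.e. $d(G)=c(G)-\lambda(G)-1\le 0$. -/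

import Mathlib

namespace SeparableGraph

/-- A graph is *separable* if there are non-negative costs on its links and a threshold `α` such
that a set `E'` of links has total cost at least `α` if and only if the spanning subgraph
`(V, E')` is connected. (Values of `cost` off the links of `G` play no role.) -/
def IsSeparable {V : Type*} (G : SimpleGraph V) : Prop :=
  ∃ (cost : Sym2 V → ℝ) (α : ℝ), (∀ e ∈ G.edgeSet, 0 ≤ cost e) ∧
    ∀ E' : Finset (Sym2 V), (E' : Set (Sym2 V)) ⊆ G.edgeSet →
      (α ≤ ∑ e ∈ E', cost e ↔ (SimpleGraph.fromEdgeSet (E' : Set (Sym2 V))).Connected)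

/-- The vectors over the field with two elements that are indicators of the link sets of the
cycles of `G`. -/
def cycleVectors {V : Type*} (G : SimpleGraph V) : Set (Sym2 V → ZMod 2) :=
  {x | ∃ (v : V) (w : G.Walk v v), w.IsCycle ∧ x = Set.indicator {e | e ∈ w.edges} 1}

/-- The *corank* of a graph: its number of independent cycles, that is, the dimension of the
cycle space over the field with two elements. -/
noncomputable def corank {V : Type*} (G : SimpleGraph V) : ℕ :=
  Module.finrank (ZMod 2) (Submodule.span (ZMod 2) (cycleVectors G))

/-- The *link connectivity* of a graph: the least number of links whose removal leaves a graph
that is not connected. For the one-node graph, which cannot be disconnected, the value is `0`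
by the usual convention. -/
noncomputable def linkConnectivity {V : Type*} (G : SimpleGraph V) : ℕ :=
  sInf {k : ℕ | ∃ F : Finset (Sym2 V), (F : Set (Sym2 V)) ⊆ G.edgeSet ∧ F.card = k ∧
    ¬ (G.deleteEdges (F : Set (Sym2 V))).Connected}

/-- The *level of difficulty* `d(G) = c(G) - λ(G) - 1`, an integer. -/
noncomputable def difficulty {V : Type*} (G : SimpleGraph V) : ℤ :=
  (corank G : ℤ) - (linkConnectivity G : ℤ) - 1

/-- A graph is *easy* if its level of difficulty is at most `0`. -/
def IsEasy {V : Type*} (G : SimpleGraph V) : Prop :=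
  difficulty G ≤ 0

end SeparableGraph

namespace SeparableGraph

open SimpleGraph

/-! Separability forces corank at most 1, and then d(G) ≤ 0 because λ(G) ≥ 0. Suppose there are two
distinct cycles. Deleting a link of each, suitably chosen, keeps G connected, so a spanning tree
plus these two links is a connected E with |V| + 1 links, containing two distinct cycles. Inside E,
some links a, a', b, b' satisfy: E − a − b and E − a' − b' are connected, while E − a − a' and E − b
− b' are not. Both pairs of sets have the same total cost, which would be at least 2α and less than
2α (`not_isSeparable_of_exchange`). -/

/-- `C` is the set of links of a cycle of `G`. -/
def IsCycleLinkSet {V : Type*} [DecidableEq V] (G : SimpleGraph V) (C : Finset (Sym2 V)) : Prop :=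
  ∃ (v : V) (w : G.Walk v v), w.IsCycle ∧ w.edges.toFinset = C

variable {V : Type*} [DecidableEq V] {G H : SimpleGraph V} {C D E : Finset (Sym2 V)}

lemma IsCycleLinkSet.subset_edgeSet (hC : IsCycleLinkSet G C) : (C : Set (Sym2 V)) ⊆ G.edgeSet := by
  obtain ⟨v, w, hw, rfl⟩ := hC
  intro e he
  exact w.edges_subset_edgeSet (by simpa using he)

lemma IsCycleLinkSet.of_subset (hC : IsCycleLinkSet G C) (h : (C : Set (Sym2 V)) ⊆ H.edgeSet) :
    IsCycleLinkSet H C := by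
  obtain ⟨v, w, hw, rfl⟩ := hC
  have hw' : ∀ e ∈ w.edges, e ∈ H.edgeSet := fun e he => h (by simpa using he)
  exact ⟨v, w.transfer H hw', hw.transfer hw', by simp⟩

lemma edgeSet_fromEdgeSet_of_subset {V : Type*} {G : SimpleGraph V} {E : Finset (Sym2 V)}
    (hE : (E : Set (Sym2 V)) ⊆ G.edgeSet) :
    (fromEdgeSet (E : Set (Sym2 V))).edgeSet = E := by
  rw [edgeSet_fromEdgeSet, sdiff_eq_left, Set.disjoint_left]
  exact fun e he => G.not_isDiag_of_mem_edgeSet (hE he)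

lemma IsCycleLinkSet.fromEdgeSet (hC : IsCycleLinkSet G C) (h : C ⊆ E)
    (hE : (E : Set (Sym2 V)) ⊆ G.edgeSet) :
    IsCycleLinkSet (fromEdgeSet (E : Set (Sym2 V))) C :=
  hC.of_subset (by rw [edgeSet_fromEdgeSet_of_subset hE]; exact_mod_cast h)

lemma IsCycleLinkSet.not_isAcyclic (hC : IsCycleLinkSet G C) : ¬ G.IsAcyclic := by
  obtain ⟨v, w, hw, -⟩ := hC
  exact fun h => h w hw

lemma IsCycleLinkSet.three_le_card (hC : IsCycleLinkSet G C) : 3 ≤ C.card := by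
  obtain ⟨v, w, hw, rfl⟩ := hC
  rw [List.toFinset_card_of_nodup hw.edges_nodup, w.length_edges]
  exact hw.three_le_length

/-! ### Parity and symmetric differences of cycles -/

lemma IsCycleLinkSet.even_card_filter (hC : IsCycleLinkSet G C) (x : V) :
    Even (C.filter (x ∈ ·)).card := by
  obtain ⟨v, w, hw, rfl⟩ := hC
  have h := (hw.isTrail.even_countP_edges_iff x).2 (fun h => absurd rfl h)
  rw [List.countP_eq_length_filter,
    ← List.toFinset_card_of_nodup (hw.edges_nodup.filter _), List.toFinset_filter] at h
  simpa using h

lemma even_card_filter_symmDiff {α : Type*} [DecidableEq α] {s t : Finset α} (p : α → Prop)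
    [DecidablePred p] (hs : Even (s.filter p).card) (ht : Even (t.filter p).card) :
    Even ((symmDiff s t).filter p).card := by
  have h : (symmDiff s t).filter p = (s.filter p \ t.filter p) ∪ (t.filter p \ s.filter p) := by
    ext a
    simp only [Finset.mem_filter, Finset.mem_symmDiff, Finset.mem_union, Finset.mem_sdiff]
    tauto
  rw [h, Finset.card_union_of_disjoint disjoint_sdiff_sdiff]
  have h1 := Finset.card_sdiff_add_card_inter (s.filter p) (t.filter p)
  have h2 := Finset.card_sdiff_add_card_inter (t.filter p) (s.filter p)
  rw [Finset.inter_comm] at h2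
  grind

/-- A nonempty set of links meeting every node evenly contains a cycle. -/
lemma exists_isCycleLinkSet_of_even [Finite V] (hE : (E : Set (Sym2 V)) ⊆ G.edgeSet)
    (hne : E.Nonempty) (heven : ∀ x, Even (E.filter (x ∈ ·)).card) :
    ∃ C ⊆ E, IsCycleLinkSet G C := by
  have hes := edgeSet_fromEdgeSet_of_subset hE
  have hadj : ∀ x y, (fromEdgeSet (E : Set (Sym2 V))).Adj x y ↔ s(x, y) ∈ E := fun x y => by
    rw [← mem_edgeSet, hes, Finset.mem_coe]
  by_cases hac : (fromEdgeSet (E : Set (Sym2 V))).IsAcyclic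
  · exfalso
    -- The start of a path has positive even degree, hence a second link; by acyclicity it leaves
    -- the path, which can thus be prolonged forever.
    have hpath : ∀ n : ℕ, ∃ (u v : V) (p : (fromEdgeSet (E : Set (Sym2 V))).Walk u v),
        p.IsPath ∧ p.length = n + 1 := by
      intro n
      induction n with
      | zero =>
        obtain ⟨e, he⟩ := hne
        induction e with
        | h u v =>
          have h := (hadj u v).2 he
          exact ⟨u, v, h.toWalk, by simp [h.ne], by simp⟩
      | succ n ih =>
        obtain ⟨u, v, p, hp, hl⟩ := ih
        have hnil : ¬ p.Nil := by
          rw [← Walk.length_eq_zero_iff]; omega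
        have hmem : s(u, p.snd) ∈ E.filter (u ∈ ·) := by
          simpa using (hadj _ _).1 (p.adj_snd hnil)
        have hcard : 1 < (E.filter (u ∈ ·)).card := by
          have := Finset.card_pos.2 ⟨_, hmem⟩
          have := heven u
          grind
        obtain ⟨e, he, hes⟩ := Finset.exists_mem_ne hcard s(u, p.snd)
        obtain ⟨heE, x, rfl⟩ := Finset.mem_filter.1 he
        have hux := (hadj u x).2 heE
        have hx : x ∉ p.support := fun hx =>
          hes (by rw [hac.eq_snd_of_adj_start hp hux hx])
        exact ⟨x, v, Walk.cons hux.symm p, by simp [hp, hx], by simp [hl]⟩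
    have := Fintype.ofFinite V
    obtain ⟨u, v, p, hp, hl⟩ := hpath (Fintype.card V)
    have := hp.length_lt
    omega
  · simp only [IsAcyclic, not_forall, not_not] at hac
    obtain ⟨v, w, hw⟩ := hac
    have hsub : w.edges.toFinset ⊆ E := fun e he => by
      rw [← Finset.mem_coe, ← hes]
      exact w.edges_subset_edgeSet (by simpa using he)
    exact ⟨_, hsub, IsCycleLinkSet.of_subset ⟨v, w, hw, rfl⟩
      ((Finset.coe_subset.2 hsub).trans hE)⟩

lemma IsCycleLinkSet.exists_subset_symmDiff [Finite V] (hC : IsCycleLinkSet G C)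
    (hD : IsCycleLinkSet G D) (hne : C ≠ D) : ∃ B ⊆ symmDiff C D, IsCycleLinkSet G B := by
  refine exists_isCycleLinkSet_of_even ?_ ?_ fun x =>
    even_card_filter_symmDiff _ (hC.even_card_filter x) (hD.even_card_filter x)
  · intro e he
    rcases Finset.mem_symmDiff.1 he with h | h
    · exact hC.subset_edgeSet h.1
    · exact hD.subset_edgeSet h.1
  · rwa [Finset.nonempty_iff_ne_empty, ← Finset.bot_eq_empty, Ne, symmDiff_eq_bot]

/-! ### Deleting links of cycles -/

/-- A link on a cycle is not a bridge. -/
lemma IsCycleLinkSet.connected_deleteEdges (hC : IsCycleLinkSet G C) (hG : G.Connected)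
    {e : Sym2 V} (he : e ∈ C) : (G.deleteEdges {e}).Connected := by
  obtain ⟨v, w, hw, rfl⟩ := hC
  induction e with
  | h x y =>
    refine hG.connected_delete_edge_of_not_isBridge fun hb => ?_
    exact hb.notMem_edges_of_isCycle hw (by simpa using he)

lemma IsCycleLinkSet.connected_erase (hC : IsCycleLinkSet G C) (hCE : C ⊆ E)
    (hE : (E : Set (Sym2 V)) ⊆ G.edgeSet) (hconn : (SimpleGraph.fromEdgeSet (E : Set (Sym2 V))).Connected)
    {e : Sym2 V} (he : e ∈ C) : (SimpleGraph.fromEdgeSet (E.erase e : Set (Sym2 V))).Connected := by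
  have h := (hC.fromEdgeSet hCE hE).connected_deleteEdges hconn he
  rwa [deleteEdges_fromEdgeSet, ← Finset.coe_singleton, ← Finset.coe_sdiff,
    Finset.sdiff_singleton_eq_erase] at h

/-- A connected spanning subgraph containing a cycle has at least as many links as nodes. -/
lemma IsCycleLinkSet.card_le [Finite V] (hC : IsCycleLinkSet G C) (hCE : C ⊆ E)
    (hE : (E : Set (Sym2 V)) ⊆ G.edgeSet)
    (hconn : (SimpleGraph.fromEdgeSet (E : Set (Sym2 V))).Connected) : Nat.card V ≤ E.card := by
  have h1 := hconn.card_vert_le_card_edgeSet_add_one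
  have h2 := mt (fun h => (isTree_iff_connected_and_card.2 ⟨hconn, h⟩).isAcyclic)
    (hC.fromEdgeSet hCE hE).not_isAcyclic
  rw [edgeSet_fromEdgeSet_of_subset hE] at h1 h2
  have h3 : Nat.card (E : Set (Sym2 V)) = E.card := by simp
  omega


/-! ### The exchange argument -/

lemma sum_erase_erase_add {α : Type*} [DecidableEq α] (s : Finset α) (f : α → ℝ) {a b : α}
    (ha : a ∈ s) (hb : b ∈ s) (hab : a ≠ b) :
    ∑ e ∈ (s.erase a).erase b, f e + f a + f b = ∑ e ∈ s, f e := by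
  rw [← Finset.sum_erase_add s f ha,
    ← Finset.sum_erase_add (s.erase a) f (Finset.mem_erase.2 ⟨hab.symm, hb⟩)]
  ring

/-- If the pairs `a, a'` and `b, b'` of links are cuts of a spanning subgraph with two more links
than a spanning tree, while `a, b` and `a', b'` are not, then the graph is not separable. -/
lemma not_isSeparable_of_exchange [Finite V] {A B : Finset (Sym2 V)}
    (hE : (E : Set (Sym2 V)) ⊆ G.edgeSet)
    (hconn : (fromEdgeSet (E : Set (Sym2 V))).Connected) (hcard : E.card = Nat.card V + 1)
    (hA : IsCycleLinkSet G A) (hB : IsCycleLinkSet G B) (hD : IsCycleLinkSet G D)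
    (hAE : A ⊆ E) (hBE : B ⊆ E) (hDE : D ⊆ E) {a a' b b' : Sym2 V} (haa : a ≠ a') (hbb : b ≠ b')
    (ha : a ∈ D \ A) (ha' : a' ∈ D \ A) (hb : b ∈ A \ B) (hb' : b' ∈ A \ B) :
    ¬ IsSeparable G := by
  rintro ⟨cost, α, -, hsep⟩
  rw [Finset.mem_sdiff] at ha ha' hb hb'
  have hsub : ∀ x y, (((E.erase x).erase y : Finset _) : Set (Sym2 V)) ⊆ G.edgeSet := fun x y =>
    (Finset.coe_subset.2 ((Finset.erase_subset _ _).trans (Finset.erase_subset _ _))).trans hE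
  -- Removing x breaks `D` but leaves `A` whole, so y still lies on a cycle.
  have hconn2 : ∀ x ∈ D \ A, ∀ y ∈ A, α ≤ ∑ e ∈ (E.erase x).erase y, cost e := by
    intro x hx y hy
    rw [Finset.mem_sdiff] at hx
    refine (hsep _ (hsub x y)).2 (hA.connected_erase ?_ ?_ ?_ hy)
    · exact fun e he => Finset.mem_erase.2 ⟨fun h => hx.2 (h ▸ he), hAE he⟩
    · exact (Finset.coe_subset.2 (Finset.erase_subset _ _)).trans hE
    · exact hD.connected_erase hDE hE hconn hx.1
  -- The remaining |V| − 1 links include the cycle `C`, so they cannot connect V.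
  have hcut : ∀ C, IsCycleLinkSet G C → C ⊆ E → ∀ x ∈ E, ∀ y ∈ E, x ≠ y → x ∉ C → y ∉ C →
      ∑ e ∈ (E.erase x).erase y, cost e < α := by
    intro C hC hCE x hx y hy hxy hxC hyC
    refine not_le.1 fun h => ?_
    have h1 := hC.card_le (fun e he => Finset.mem_erase.2 ⟨ne_of_mem_of_not_mem he hyC,
      Finset.mem_erase.2 ⟨ne_of_mem_of_not_mem he hxC, hCE he⟩⟩) (hsub x y) ((hsep _ (hsub x y)).1 h)
    have h2 := Finset.card_erase_add_one hx
    have h3 := Finset.card_erase_add_one (Finset.mem_erase.2 ⟨hxy.symm, hy⟩)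
    omega
  have h1 := hconn2 a (Finset.mem_sdiff.2 ha) b hb.1
  have h2 := hconn2 a' (Finset.mem_sdiff.2 ha') b' hb'.1
  have h3 := hcut A hA hAE a (hDE ha.1) a' (hDE ha'.1) haa ha.2 ha'.2
  have h4 := hcut B hB hBE b (hAE hb.1) b' (hAE hb'.1) hbb hb.2 hb'.2
  have s1 := sum_erase_erase_add E cost (hDE ha.1) (hAE hb.1) (fun h => ha.2 (h ▸ hb.1))
  have s2 := sum_erase_erase_add E cost (hDE ha'.1) (hAE hb'.1) (fun h => ha'.2 (h ▸ hb'.1))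
  have s3 := sum_erase_erase_add E cost (hDE ha.1) (hDE ha'.1) haa
  have s4 := sum_erase_erase_add E cost (hAE hb.1) (hAE hb'.1) hbb
  linarith

/-- Two distinct cycles inside a connected spanning subgraph with two more links than a spanning
tree prevent separability. -/
lemma not_isSeparable_of_two_cycles [Finite V] (hE : (E : Set (Sym2 V)) ⊆ G.edgeSet)
    (hconn : (fromEdgeSet (E : Set (Sym2 V))).Connected) (hcard : E.card = Nat.card V + 1)
    (hC : IsCycleLinkSet G C) (hD : IsCycleLinkSet G D) (hCE : C ⊆ E) (hDE : D ⊆ E)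
    (hne : C ≠ D) : ¬ IsSeparable G := by
  obtain ⟨B, hBs, hB⟩ := hC.exists_subset_symmDiff hD hne
  have hBE : B ⊆ E := fun e he => by
    rcases Finset.mem_symmDiff.1 (hBs he) with h | h
    exacts [hCE h.1, hDE h.1]
  -- The third cycle `B` avoids the links common to `C` and `D`.
  have hCD : C ∩ D ⊆ C \ B ∧ D ∩ C ⊆ D \ B := by
    constructor <;>
    · intro e he
      rw [Finset.mem_inter] at he
      refine Finset.mem_sdiff.2 ⟨he.1, fun heB => ?_⟩
      have := Finset.mem_symmDiff.1 (hBs heB)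
      tauto
  have hBcard : 3 ≤ (C \ D).card + (D \ C).card := by
    rw [← Finset.card_union_of_disjoint disjoint_sdiff_sdiff]
    exact hB.three_le_card.trans (Finset.card_le_card hBs)
  have h1 := Finset.card_sdiff_add_card_inter C D
  have h2 := Finset.card_sdiff_add_card_inter D C
  have h3 := hC.three_le_card
  have h4 := hD.three_le_card
  -- Since cycles have at least three links, at least two of `C \ D`, `D \ C`, `C ∩ D` have two or
  -- more links; these supply the two pairs.
  by_cases hX : 1 < (C \ D).card
  · obtain ⟨a, ha, a', ha', haa⟩ := Finset.one_lt_card.1 hX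
    by_cases hY : 1 < (D \ C).card
    · obtain ⟨b, hb, b', hb', hbb⟩ := Finset.one_lt_card.1 hY
      exact not_isSeparable_of_exchange hE hconn hcard hD hC hC hDE hCE hCE haa hbb ha ha' hb hb'
    · obtain ⟨b, hb, b', hb', hbb⟩ := Finset.one_lt_card.1 (show 1 < (D ∩ C).card by omega)
      exact not_isSeparable_of_exchange hE hconn hcard hD hB hC hDE hBE hCE haa hbb ha ha'
        (hCD.2 hb) (hCD.2 hb')
  · obtain ⟨a, ha, a', ha', haa⟩ := Finset.one_lt_card.1 (show 1 < (D \ C).card by omega)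
    obtain ⟨b, hb, b', hb', hbb⟩ := Finset.one_lt_card.1 (show 1 < (C ∩ D).card by omega)
    exact not_isSeparable_of_exchange hE hconn hcard hC hB hD hCE hBE hDE haa hbb ha ha'
      (hCD.1 hb) (hCD.1 hb')

/-! ### From two cycles to corank -/

/-- A link added to a connected spanning subgraph closes a cycle. -/
lemma exists_isCycleLinkSet_insert (hE : (E : Set (Sym2 V)) ⊆ G.edgeSet)
    (hconn : (fromEdgeSet (E : Set (Sym2 V))).Connected) {e : Sym2 V} (he : e ∈ G.edgeSet)
    (heE : e ∉ E) : ∃ C ⊆ insert e E, e ∈ C ∧ IsCycleLinkSet G C := by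
  have hE' : ((insert e E : Finset _) : Set (Sym2 V)) ⊆ G.edgeSet := by
    rw [Finset.coe_insert]
    exact Set.insert_subset he hE
  have hes := edgeSet_fromEdgeSet_of_subset hE'
  have hmem : e ∈ (fromEdgeSet ((insert e E : Finset _) : Set (Sym2 V))).edgeSet := by
    rw [hes]; simp
  have hb : ¬ (fromEdgeSet ((insert e E : Finset _) : Set (Sym2 V))).IsBridge e := by
    induction e with
    | h x y =>
      rw [isBridge_iff, not_not, deleteEdges_fromEdgeSet, ← Finset.coe_singleton,
        ← Finset.coe_sdiff, Finset.sdiff_singleton_eq_erase, Finset.erase_insert heE]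
      exact hconn.preconnected x y
  rw [isBridge_iff_forall_cycle_notMem hmem] at hb
  push Not at hb
  obtain ⟨v, w, hw, hew⟩ := hb
  have hsub : w.edges.toFinset ⊆ insert e E := fun f hf => by
    rw [← Finset.mem_coe, ← hes]
    exact w.edges_subset_edgeSet (by simpa using hf)
  exact ⟨_, hsub, by simpa using hew, IsCycleLinkSet.of_subset ⟨v, w, hw, rfl⟩
    ((Finset.coe_subset.2 hsub).trans hE')⟩

/-- A graph that stays connected after removing two links is not separable. -/
lemma not_isSeparable_of_connected_deleteEdges [Finite V] {e f : Sym2 V} (he : e ∈ G.edgeSet)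
    (hf : f ∈ G.edgeSet) (hef : e ≠ f) (hconn : (G.deleteEdges {e, f}).Connected) :
    ¬ IsSeparable G := by
  obtain ⟨T, hTG, hT⟩ := hconn.exists_isTree_le
  have := Fintype.ofFinite V
  classical
  have hTe : fromEdgeSet (T.edgeFinset : Set (Sym2 V)) = T := by simp
  have hTsub : (T.edgeFinset : Set (Sym2 V)) ⊆ G.edgeSet := by
    rw [coe_edgeFinset]
    exact edgeSet_mono (hTG.trans (deleteEdges_le _))
  have hTc : (fromEdgeSet (T.edgeFinset : Set (Sym2 V))).Connected := hTe.symm ▸ hT.connected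
  have hnot : ∀ x ∈ ({e, f} : Set (Sym2 V)), x ∉ T.edgeFinset := fun x hx hxT => by
    have := edgeSet_mono hTG (mem_edgeFinset.1 hxT)
    rw [edgeSet_deleteEdges] at this
    exact this.2 hx
  have heT := hnot e (by simp)
  have hfT := hnot f (by simp)
  obtain ⟨C, hCs, heC, hC⟩ := exists_isCycleLinkSet_insert hTsub hTc he heT
  obtain ⟨D, hDs, hfD, hD⟩ := exists_isCycleLinkSet_insert hTsub hTc hf hfT
  have hfC : f ∉ C := fun h => by
    rcases Finset.mem_insert.1 (hCs h) with h | h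
    exacts [hef h.symm, hfT h]
  refine not_isSeparable_of_two_cycles (E := insert e (insert f T.edgeFinset)) ?_ ?_ ?_ hC hD
    (hCs.trans (Finset.insert_subset_insert _ (Finset.subset_insert _ _)))
    (hDs.trans (Finset.subset_insert _ _)) (fun h => hfC (h ▸ hfD))
  · rw [Finset.coe_insert, Finset.coe_insert]
    exact Set.insert_subset he (Set.insert_subset hf hTsub)
  · refine hTc.mono (fromEdgeSet_mono (Finset.coe_subset.2 ?_))
    exact (Finset.subset_insert _ _).trans (Finset.subset_insert _ _)
  · rw [Finset.card_insert_of_notMem (by simp [hef, heT]), Finset.card_insert_of_notMem hfT,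
      hT.card_edgeFinset, Nat.card_eq_fintype_card]

/-- If all cycles of a finite graph have the same link set, its corank is at most one. -/
lemma corank_le_one [Finite V]
    (h : ∀ C D, IsCycleLinkSet G C → IsCycleLinkSet G D → C = D) : corank G ≤ 1 := by
  have hsub : (cycleVectors G).Subsingleton := by
    rintro _ ⟨v, w, hw, rfl⟩ _ ⟨v', w', hw', rfl⟩
    have h' := h _ _ ⟨v, w, hw, rfl⟩ ⟨v', w', hw', rfl⟩
    have : {e | e ∈ w.edges} = {e | e ∈ w'.edges} := by
      ext e
      simpa using Finset.ext_iff.1 h' e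
    rw [this]
  rw [corank]
  rcases hsub.eq_empty_or_singleton with h0 | ⟨x, hx⟩
  · rw [h0, Submodule.span_empty, finrank_bot]
    exact zero_le_one
  · rw [hx]
    simpa using finrank_span_le_card (R := ZMod 2) ({x} : Set (Sym2 V → ZMod 2))

/-- A separable connected finite graph has at most one independent cycle. -/
theorem IsSeparable.corank_le_one [Finite V] (hG : G.Connected) (hsep : IsSeparable G) :
    corank G ≤ 1 := by
  -- If e is in `C` but not in `D`, then `D` survives the deletion of e, so a link of `D` can be
  -- deleted as well.
  have key : ∀ C D, IsCycleLinkSet G C → IsCycleLinkSet G D → C ⊆ D := by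
    intro C D hC hD e heC
    by_contra heD
    have hDe : IsCycleLinkSet (G.deleteEdges {e}) D := hD.of_subset fun f hf => by
      rw [edgeSet_deleteEdges]
      exact ⟨hD.subset_edgeSet hf, fun h => heD (h ▸ hf)⟩
    obtain ⟨f, hf⟩ := Finset.card_pos.1 (zero_lt_three.trans_le hD.three_le_card)
    have hconn := hDe.connected_deleteEdges (hC.connected_deleteEdges hG heC) hf
    rw [deleteEdges_deleteEdges, Set.singleton_union] at hconn
    exact not_isSeparable_of_connected_deleteEdges (hC.subset_edgeSet heC) (hD.subset_edgeSet hf)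
      (ne_of_mem_of_not_mem hf heD).symm hconn hsep
  exact SeparableGraph.corank_le_one fun C D hC hD => (key C D hC hD).antisymm (key D C hD hC)

end SeparableGraph

theorem mainTheorem11 {V : Type*} [Finite V] (G : SimpleGraph V) (hconn : G.Connected)
    (hsep : SeparableGraph.IsSeparable G) : SeparableGraph.IsEasy G := by
  classical
  have h := hsep.corank_le_one hconn
  rw [SeparableGraph.IsEasy, SeparableGraph.difficulty]
  omega
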